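/- **Setting.** Let $A\in\mathbb R^{n\times m}$ have rows $a_1^t,\dots,a_n^t$, let $B=n^{-1}A^tA$, and let $\|\cdot\|$ denote the Euclidean norm of vectors and the spectral norm of matrices. Let $y^\dag$ be exact data, $x_1\in\mathbb R^m$ an initial guess, $x^\dag$ the solution of $Ax=y^\dag$ that minimizes $\|x-x_1\|$, and $y^\delta=y^\dag+\xi$ noisy data with noise level $\delta=\|\xi\|$. The SGD iterates are $x_1^\delta=x_1$ and $$x_{k+1}^\delta=x_k^\delta-\eta_k\big((a_{i_k},x_k^\delta)-y^\delta_{i_k}\big)a_{i_k},\qquad k=1,2,\dots,$$ where the indices $i_1,i_2,\dots$ are drawn i.i.d. uniformly from $\{1,\dots,n\}$. Write $e_k^\delta=x_k^\delta-x^\dag$. **Assumptions.** $\|B\|\le 1$, and: (i) $\eta_j=c_0j^{-\alpha}$ with $c_0>0$, $\alpha\in[0,1)$, $c_0\le\min\big((\max_i\|a_i\|^2)^{-1},1\big)$ and $c_0\|B\|\le(2e)^{-1}$; (ii) $x^\dag-x_1=B^\nu w$ for some $w\in\mathbb R^m$ and $\nu>\tfrac12$; (iii) $A=\Sigma V^t$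 with $\Sigma$ diagonal (possibly rectangular) and nonnegative, and $V$ with orthonormal columns. **Theorem.** Let $\nu>\tfrac12$ and $\alpha\in[0,1)$. There is $\kappa>0$, depending only on $\nu$ and $\alpha$, such that for all $n\ge1$ and $0<c_0\le\kappa/n$ there are constants $c_*$, $c_{**}$ depending only on $\nu,n,c_0,\alpha$ such that, in every instance satisfying these assumptions (for any $m$, $A$, $x_1$, $w$, $\xi$), for all $k\ge1$, $$\mathbb E\big[\|e_k^\delta\|^2\big]\le c_*\,k^{-2\nu(1-\alpha)}\|w\|^2+c_{**}\,\delta^2k^{1-\alpha}.$$ Moreover, for all $a,b>0$ there is a constant $c$ depending only on $\nu,n,c_0,\alpha,a,b$ such that, in every such instance with $\delta>0$, every stopping index $k\ge1$ with $$a\,(\|w\|\delta^{-1})^{\frac{2}{(1+2\nu)(1-\alpha)}}\le k\le b\,(\|w\|\delta^{-1})^{\frac{2}{(1+2\nu)(1-\alpha)}}$$ satisfies $$\mathbb E\big[\|e_k^\delta\|^2\big]^{\frac12}\le c\,\|w\|^{\frac1{1+2\nu}}\,\delta^{\frac{2\nu}{1+2\nu}}.$$ -/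

import Mathlib

open MeasureTheory ProbabilityTheory
open scoped Matrix ENNReal

/-- The `i`-th row `a_i` of `A`, as a vector of the Euclidean space `ℝ^m`. -/
noncomputable def rowVec {n m : ℕ} (A : Matrix (Fin n) (Fin m) ℝ) (i : Fin n) :
    EuclideanSpace ℝ (Fin m) :=
  WithLp.toLp 2 (A i)

/-- `B = n⁻¹ Aᵗ A`. -/
noncomputable def normalMatrix {n m : ℕ} (A : Matrix (Fin n) (Fin m) ℝ) :
    Matrix (Fin m) (Fin m) ℝ :=
  (n : ℝ)⁻¹ • (Aᵀ * A)

/-- The spectral norm `‖B‖` of a square matrix (operator norm for the Euclidean norm). -/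
noncomputable def matrixOpNorm {m : ℕ} (B : Matrix (Fin m) (Fin m) ℝ) : ℝ :=
  ‖Matrix.toEuclideanCLM (n := Fin m) (𝕜 := ℝ) B‖

/-- The fractional power `B ^ ν` (`ν > 0`) of a symmetric positive semidefinite matrix,
through the functional calculus of `B`. -/
noncomputable def fracPow {m : ℕ} (B : Matrix (Fin m) (Fin m) ℝ) (ν : ℝ) :
    Matrix (Fin m) (Fin m) ℝ :=
  cfc (fun t : ℝ => t ^ ν) B

/-- The polynomially decaying stepsize `η_j = c₀ j ^ (-α)`, `j = 1, 2, …`. -/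
noncomputable def stepsize (c₀ α : ℝ) (j : ℕ) : ℝ := c₀ * (j : ℝ) ^ (-α)

/-- The SGD iterate `x_k`, `k = 1, 2, …`, with data `y`, stepsizes `η`, initial guess `x₁` and
row indices `i 1, i 2, …`:  `x_{k+1} = x_k - η_k ((a_{i_k}, x_k) - y_{i_k}) a_{i_k}`.
The value at `0` is a placeholder. -/
noncomputable def sgd {n m : ℕ} (A : Matrix (Fin n) (Fin m) ℝ) (y : EuclideanSpace ℝ (Fin n))
    (η : ℕ → ℝ) (x₁ : EuclideanSpace ℝ (Fin m)) (i : ℕ → Fin n) :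
    ℕ → EuclideanSpace ℝ (Fin m)
  | 0 => x₁
  | 1 => x₁
  | k + 2 =>
    sgd A y η x₁ i (k + 1) -
      (η (k + 1) * (inner ℝ (rowVec A (i (k + 1))) (sgd A y η x₁ i (k + 1)) - y (i (k + 1)))) •
        rowVec A (i (k + 1))

/-- The random row indices `i_1, i_2, …` are i.i.d. and uniform on the `n` rows. -/
structure IsUniformSampling {n : ℕ} {Ω : Type*} [MeasurableSpace Ω] (P : Measure Ω)
    (i : ℕ → Ω → Fin n) : Prop where
  measurable : ∀ k, 1 ≤ k → Measurable (i k)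
  indep : iIndepFun (fun k : ℕ => i (k + 1)) P
  uniform : ∀ k, 1 ≤ k → ∀ r : Fin n, P {ω | i k ω = r} = (n : ℝ≥0∞)⁻¹

/-- `x` is the solution of `A x = y` that is closest to `x₁`. -/
def IsMinNormSolution {n m : ℕ} (A : Matrix (Fin n) (Fin m) ℝ) (y : EuclideanSpace ℝ (Fin n))
    (x₁ x : EuclideanSpace ℝ (Fin m)) : Prop :=
  Matrix.toEuclideanLin A x = y ∧
    ∀ z : EuclideanSpace ℝ (Fin m), Matrix.toEuclideanLin A z = y → ‖x - x₁‖ ≤ ‖z - x₁‖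

/-- `A = Σ Vᵗ` with `Σ` (rectangular) diagonal and nonnegative and `V` column orthonormal. -/
def HasDiagonalForm {n m : ℕ} (A : Matrix (Fin n) (Fin m) ℝ) : Prop :=
  ∃ (r : ℕ) (S : Matrix (Fin n) (Fin r) ℝ) (V : Matrix (Fin m) (Fin r) ℝ),
    (∀ (i : Fin n) (j : Fin r), (i : ℕ) ≠ (j : ℕ) → S i j = 0) ∧ (∀ i j, 0 ≤ S i j) ∧ Vᵀ * V = 1 ∧ A = S * Vᵀ

/-- The standing assumptions on the matrix, the initial stepsize, and the exact solution. -/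
structure StandingAssumption {n m : ℕ} (A : Matrix (Fin n) (Fin m) ℝ) (c₀ ν : ℝ)
    (x₁ xdag w : EuclideanSpace ℝ (Fin m)) : Prop where
  norm_le_one : matrixOpNorm (normalMatrix A) ≤ 1
  /-- `c₀ ≤ (max_i ‖a_i‖²)⁻¹`, without division so that `A = 0` imposes nothing. -/
  step_row : ∀ i, c₀ * ‖rowVec A i‖ ^ 2 ≤ 1
  step_one : c₀ ≤ 1
  step_norm : c₀ * matrixOpNorm (normalMatrix A) ≤ (2 * Real.exp 1)⁻¹
  source : xdag - x₁ = Matrix.toEuclideanLin (fracPow (normalMatrix A) ν) w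
  diagonal : HasDiagonalForm A

/-- The squared error `‖x_k - x†‖²` of the SGD iterate, as a random variable. -/
noncomputable def sqError {n m : ℕ} {Ω : Type*} (A : Matrix (Fin n) (Fin m) ℝ)
    (y : EuclideanSpace ℝ (Fin n)) (η : ℕ → ℝ) (x₁ xdag : EuclideanSpace ℝ (Fin m))
    (i : ℕ → Ω → Fin n) (k : ℕ) (ω : Ω) : ℝ :=
  ‖sgd A y η x₁ (fun j => i j ω) k - xdag‖ ^ 2

/-!
The diagonal form `A = Σ Vᵗ` makes the rows `a_r` of `A` orthogonal, and this decouples the iteration.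
The rows are eigenvectors of `B` for the eigenvalues `μ_r = ‖a_r‖² / n`, and the vectors orthogonal to
all of them form its kernel, so the source condition gives
`x₁ - x† = -∑ μ_r ^ ν ((a_r, w) / ‖a_r‖²) a_r`, and every error stays in the span of the rows. The
coordinate of the error along `a_r` is a scalar random recursion (`sgdCoeff`), which moves only when
the row `r` is drawn and then becomes a convex combination of itself and of `ξ_r / ‖a_r‖²`.

By convexity and independence, the second moment `q_k` of the component along `a_r` satisfies
`q_{k+1} ≤ (1 - η_k μ_r) q_k + η_k ξ_r² / n`, hence
`q_{k+1} ≤ exp (-μ_r ∑_{j ≤ k} η_j) q_1 + (ξ_r² / n) ∑_{j ≤ k} η_j`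
(`IsUniformSampling.integral_sgdCoeff_sq_le`). Since `∑_{j ≤ k} j ^ (-α)` lies between `k ^ (1 - α)` and
`k ^ (1 - α) / (1 - α)`, and `x ^ (2ν) exp (-x)` is bounded, the first term is at most a constant times
`k ^ (-2ν(1 - α)) (a_r, w)² / ‖a_r‖²` (`rpow_mul_exp_neg_sum_stepsize_le`). Summing over `r`, with
Bessel's inequality for `w`, gives the error bound (`integral_sqError_succ_le`), and balancing its two
terms gives the rate at the stopping index (`sqrt_le_of_stopping_index`).
-/

/-! ### Orthogonal families -/

lemma norm_sum_smul_sq_of_orthogonal {ι E : Type*} [Fintype ι] [NormedAddCommGroup E]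
    [InnerProductSpace ℝ E] {a : ι → E} (ha : Pairwise fun i j => inner ℝ (a i) (a j) = 0)
    (c : ι → ℝ) : ‖∑ i, c i • a i‖ ^ 2 = ∑ i, c i ^ 2 * ‖a i‖ ^ 2 := by
  rw [← real_inner_self_eq_norm_sq, sum_inner]
  refine Finset.sum_congr rfl fun i _ => ?_
  rw [inner_sum, Finset.sum_eq_single i]
  · rw [inner_smul_left, inner_smul_right, real_inner_self_eq_norm_sq]
    simp only [conj_trivial]
    ring
  · intro j _ hj
    rw [inner_smul_left, inner_smul_right, ha hj.symm]
    simp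
  · simp

lemma inner_sum_smul_of_orthogonal {ι E : Type*} [Fintype ι] [NormedAddCommGroup E]
    [InnerProductSpace ℝ E] {a : ι → E} (ha : Pairwise fun i j => inner ℝ (a i) (a j) = 0)
    (c : ι → ℝ) (i : ι) : inner ℝ (a i) (∑ j, c j • a j) = c i * ‖a i‖ ^ 2 := by
  rw [inner_sum, Finset.sum_eq_single i]
  · rw [inner_smul_right, real_inner_self_eq_norm_sq]
  · intro j _ hj
    rw [inner_smul_right, ha hj.symm, mul_zero]
  · simp

/-- Removing from `w` its components along an orthogonal family `a` leaves a vector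
orthogonal to `a`; zero vectors of the family contribute nothing, since `x / 0 = 0`. -/
lemma inner_sub_projection_eq_zero {ι E : Type*} [Fintype ι] [NormedAddCommGroup E]
    [InnerProductSpace ℝ E] {a : ι → E} (ha : Pairwise fun i j => inner ℝ (a i) (a j) = 0)
    (w : E) (i : ι) :
    inner ℝ (a i) (w - ∑ j, (inner ℝ (a j) w / ‖a j‖ ^ 2) • a j) = 0 := by
  rw [inner_sub_right, inner_sum_smul_of_orthogonal ha]
  by_cases h : a i = 0
  · simp [h]
  · have : ‖a i‖ ^ 2 ≠ 0 := by simpa using h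
    field_simp
    ring

/-- Bessel's inequality for an orthogonal family that need not be normalized. -/
lemma sum_inner_sq_div_norm_sq_le {ι E : Type*} [Fintype ι] [NormedAddCommGroup E]
    [InnerProductSpace ℝ E] {a : ι → E} (ha : Pairwise fun i j => inner ℝ (a i) (a j) = 0)
    (w : E) : ∑ i, inner ℝ (a i) w ^ 2 / ‖a i‖ ^ 2 ≤ ‖w‖ ^ 2 := by
  set p := ∑ j, (inner ℝ (a j) w / ‖a j‖ ^ 2) • a j with hp
  have horth : inner ℝ p (w - p) = 0 := by
    rw [hp, sum_inner]
    refine Finset.sum_eq_zero fun i _ => ?_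
    rw [inner_smul_left, inner_sub_projection_eq_zero ha, mul_zero]
  have hsum : ‖p‖ ^ 2 = ∑ i, inner ℝ (a i) w ^ 2 / ‖a i‖ ^ 2 := by
    rw [hp, norm_sum_smul_sq_of_orthogonal ha]
    refine Finset.sum_congr rfl fun i _ => ?_
    by_cases h : a i = 0
    · simp [h]
    · have : ‖a i‖ ^ 2 ≠ 0 := by simpa using h
      field_simp
  have hw : ‖w‖ ^ 2 = ‖p‖ ^ 2 + ‖w - p‖ ^ 2 := by
    have := norm_add_sq_real p (w - p)
    rw [horth, add_sub_cancel] at this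
    linarith
  rw [← hsum, hw]
  nlinarith [sq_nonneg ‖w - p‖]

/-! ### Functional calculus of the normal matrix -/

lemma aeval_mulVec_of_mulVec_eq {m : Type*} [Fintype m] [DecidableEq m] {B : Matrix m m ℝ}
    {v : m → ℝ} {μ : ℝ} (hv : B *ᵥ v = μ • v) (p : Polynomial ℝ) :
    Polynomial.aeval B p *ᵥ v = p.eval μ • v := by
  induction p using Polynomial.induction_on' with
  | add p q hp hq => simp [Matrix.add_mulVec, hp, hq, add_smul]
  | monomial k c =>
    have hpow : ∀ k : ℕ, (B ^ k) *ᵥ v = μ ^ k • v := by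
      intro k
      induction k with
      | zero => simp
      | succ k ih =>
        rw [pow_succ, ← Matrix.mulVec_mulVec, hv, Matrix.mulVec_smul, ih, smul_smul, pow_succ,
          mul_comm]
    rw [Polynomial.aeval_monomial, Polynomial.eval_monomial, ← Algebra.smul_def,
      Matrix.smul_mulVec, hpow, smul_smul]

/-- The functional calculus acts on an eigenvector by the value of the function at the eigenvalue:
on the finite spectrum, `f` coincides with an interpolating polynomial. -/
lemma cfc_mulVec_of_mulVec_eq {m : Type*} [Fintype m] [DecidableEq m] {B : Matrix m m ℝ}
    (hB : IsSelfAdjoint B) {v : m → ℝ} {μ : ℝ} (hv : B *ᵥ v = μ • v) (f : ℝ → ℝ) :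
    cfc f B *ᵥ v = f μ • v := by
  classical
  have hfin : (insert μ (spectrum ℝ B)).Finite := B.finite_real_spectrum.insert μ
  set p := Lagrange.interpolate hfin.toFinset id f
  have hp : ∀ t ∈ insert μ (spectrum ℝ B), p.eval t = f t := fun t ht =>
    Lagrange.eval_interpolate_at_node (v := id) f Function.injective_id.injOn
      (hfin.mem_toFinset.2 ht)
  have hcfc : cfc f B = Polynomial.aeval B p := by
    rw [← cfc_polynomial p B hB]
    exact cfc_congr fun t ht => (hp t (Set.mem_insert_of_mem _ ht)).symm
  rw [hcfc, aeval_mulVec_of_mulVec_eq hv, hp μ (Set.mem_insert _ _)]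

lemma isSelfAdjoint_normalMatrix {n m : ℕ} (A : Matrix (Fin n) (Fin m) ℝ) :
    IsSelfAdjoint (normalMatrix A) := by
  rw [← Matrix.isHermitian_iff_isSelfAdjoint, Matrix.IsHermitian, normalMatrix,
    Matrix.conjTranspose_eq_transpose_of_trivial, Matrix.transpose_smul, Matrix.transpose_mul,
    Matrix.transpose_transpose]

lemma inner_rowVec {n m : ℕ} (A : Matrix (Fin n) (Fin m) ℝ) (i : Fin n)
    (x : EuclideanSpace ℝ (Fin m)) :
    inner ℝ (rowVec A i) x = Matrix.toEuclideanLin A x i := by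
  simp [rowVec, PiLp.inner_apply, Matrix.toLpLin_apply, Matrix.mulVec, dotProduct, mul_comm]

/-- `B x = n⁻¹ ∑ i, (a_i, x) a_i`. -/
lemma normalMatrix_mulVec {n m : ℕ} (A : Matrix (Fin n) (Fin m) ℝ)
    (x : EuclideanSpace ℝ (Fin m)) :
    normalMatrix A *ᵥ x.ofLp
      = ((n : ℝ)⁻¹ • ∑ i, inner ℝ (rowVec A i) x • rowVec A i).ofLp := by
  ext l
  rw [normalMatrix, Matrix.smul_mulVec, ← Matrix.mulVec_mulVec]
  simp only [inner_rowVec]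
  simp [-Matrix.mulVec_mulVec, rowVec, Matrix.toLpLin_apply, Matrix.mulVec, dotProduct, mul_comm]

/-- If the rows of `A` are orthogonal, they are eigenvectors of `B` and the vectors orthogonal to
them form its kernel, so that `B ^ ν` is explicit. -/
lemma fracPow_normalMatrix_apply {n m : ℕ} {A : Matrix (Fin n) (Fin m) ℝ}
    (ha : Pairwise fun i j => inner ℝ (rowVec A i) (rowVec A j) = 0) {ν : ℝ} (hν : ν ≠ 0)
    (w : EuclideanSpace ℝ (Fin m)) :
    Matrix.toEuclideanLin (fracPow (normalMatrix A) ν) w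
      = ∑ i, ((‖rowVec A i‖ ^ 2 / n) ^ ν * (inner ℝ (rowVec A i) w / ‖rowVec A i‖ ^ 2)) •
          rowVec A i := by
  set T := Matrix.toEuclideanLin (fracPow (normalMatrix A) ν) with hT
  have key : ∀ (v : EuclideanSpace ℝ (Fin m)) (μ : ℝ),
      ((n : ℝ)⁻¹ • ∑ i, inner ℝ (rowVec A i) v • rowVec A i) = μ • v → T v = μ ^ ν • v := by
    intro v μ h
    have hv : normalMatrix A *ᵥ v.ofLp = μ • v.ofLp := by
      rw [normalMatrix_mulVec, h, WithLp.ofLp_smul]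
    have := cfc_mulVec_of_mulVec_eq (isSelfAdjoint_normalMatrix A) hv (fun t : ℝ => t ^ ν)
    apply WithLp.ofLp_injective
    rw [hT, Matrix.toLpLin_apply, WithLp.ofLp_smul]
    exact this
  have hrow : ∀ i, T (rowVec A i) = (‖rowVec A i‖ ^ 2 / n) ^ ν • rowVec A i := by
    refine fun i => key _ _ ?_
    rw [Finset.sum_eq_single i, real_inner_self_eq_norm_sq, smul_smul, div_eq_inv_mul]
    · intro j _ hj
      rw [ha hj, zero_smul]
    · simp
  have hker : T (w - ∑ j, (inner ℝ (rowVec A j) w / ‖rowVec A j‖ ^ 2) • rowVec A j) = 0 := by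
    rw [key _ 0, Real.zero_rpow hν, zero_smul]
    simp [inner_sub_projection_eq_zero ha]
  rw [map_sub, sub_eq_zero] at hker
  rw [hker, map_sum]
  refine Finset.sum_congr rfl fun i _ => ?_
  rw [map_smul, hrow, smul_smul, mul_comm]

/-- Since `Vᵗ V = 1`, `A Aᵗ = Σ Σᵗ` is diagonal. -/
lemma HasDiagonalForm.pairwise_inner_rowVec {n m : ℕ} {A : Matrix (Fin n) (Fin m) ℝ}
    (hA : HasDiagonalForm A) : Pairwise fun i j => inner ℝ (rowVec A i) (rowVec A j) = 0 := by
  obtain ⟨r, S, V, hS, -, hV, rfl⟩ := hA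
  intro i j hij
  have hgram : (S * Vᵀ) * (S * Vᵀ)ᵀ = S * Sᵀ := by
    rw [Matrix.transpose_mul, Matrix.transpose_transpose, Matrix.mul_assoc, ← Matrix.mul_assoc Vᵀ,
      hV, Matrix.one_mul]
  have hinner : inner ℝ (rowVec (S * Vᵀ) i) (rowVec (S * Vᵀ) j)
      = ((S * Vᵀ) * (S * Vᵀ)ᵀ) i j := by
    rw [inner_rowVec, rowVec, Matrix.toLpLin_apply, Matrix.mul_apply]
    simp only [Matrix.mulVec, dotProduct, Matrix.transpose_apply]
  rw [hinner, hgram, Matrix.mul_apply]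
  refine Finset.sum_eq_zero fun l _ => ?_
  by_cases hl : (i : ℕ) = l
  · rw [Matrix.transpose_apply, hS j l fun h => hij (Fin.ext (hl.trans h.symm)), mul_zero]
  · rw [hS i l hl, zero_mul]

/-! ### The coordinates of the error -/

/-- The coordinate of the SGD error along the row `a_r`, after `k` steps, when the rows are
orthogonal: `s` stands for `‖a_r‖²`, `ξ` for the noise in the `r`-th datum and `c` for the initial
coordinate. A step changes the coordinate only if it draws the row `r`. The `k`-th value belongs to
the iterate `x_{k+1}`. -/
noncomputable def sgdCoeff {n : ℕ} (s ξ : ℝ) (η : ℕ → ℝ) (c : ℝ) (r : Fin n) (j : ℕ → Fin n) :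
    ℕ → ℝ
  | 0 => c
  | k + 1 =>
    if j (k + 1) = r then
      sgdCoeff s ξ η c r j k - η (k + 1) * (s * sgdCoeff s ξ η c r j k - ξ)
    else sgdCoeff s ξ η c r j k

lemma sgd_sub_eq_sum {n m : ℕ} {A : Matrix (Fin n) (Fin m) ℝ}
    (ha : Pairwise fun i j => inner ℝ (rowVec A i) (rowVec A j) = 0)
    {x₁ xdag : EuclideanSpace ℝ (Fin m)} {ydag : EuclideanSpace ℝ (Fin n)}
    (hx : Matrix.toEuclideanLin A xdag = ydag) (ξ : EuclideanSpace ℝ (Fin n)) (η : ℕ → ℝ)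
    {c : Fin n → ℝ} (hc : x₁ - xdag = ∑ r, c r • rowVec A r) (j : ℕ → Fin n) (k : ℕ) :
    sgd A (ydag + ξ) η x₁ j (k + 1) - xdag
      = ∑ r, sgdCoeff (‖rowVec A r‖ ^ 2) (ξ r) η (c r) r j k • rowVec A r := by
  induction k with
  | zero => simpa [sgd, sgdCoeff] using hc
  | succ k ih =>
    set C := fun r => sgdCoeff (‖rowVec A r‖ ^ 2) (ξ r) η (c r) r j k with hC
    set x := sgd A (ydag + ξ) η x₁ j (k + 1) with hxk
    set q := j (k + 1) with hq
    have hres : inner ℝ (rowVec A q) x - (ydag + ξ) q = ‖rowVec A q‖ ^ 2 * C q - ξ q := by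
      have h1 : inner ℝ (rowVec A q) (x - xdag) = C q * ‖rowVec A q‖ ^ 2 := by
        rw [ih, inner_sum_smul_of_orthogonal ha]
      rw [inner_sub_right, inner_rowVec A q xdag, hx] at h1
      rw [PiLp.add_apply]
      linarith
    have hstep : sgd A (ydag + ξ) η x₁ j (k + 1 + 1) = x -
        (η (k + 1) * (inner ℝ (rowVec A q) x - (ydag + ξ) q)) • rowVec A q := rfl
    have hsingle : (η (k + 1) * (‖rowVec A q‖ ^ 2 * C q - ξ q)) • rowVec A q
        = ∑ r, (if q = r then η (k + 1) * (‖rowVec A r‖ ^ 2 * C r - ξ r) else 0) •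
            rowVec A r := by
      simp [ite_smul]
    rw [hstep, hres, sub_right_comm, ih, hsingle, ← Finset.sum_sub_distrib]
    refine Finset.sum_congr rfl fun r _ => ?_
    rw [← sub_smul]
    congr 1
    by_cases h : q = r
    · simp [sgdCoeff, hC, ← hq, h]
    · simp [sgdCoeff, ← hq, h]

/-- The coordinate after `k` steps as a function of the first `k` draws. -/
lemma exists_sgdCoeff_eq {n : ℕ} (s ξ : ℝ) (η : ℕ → ℝ) (c : ℝ) (r : Fin n) (k : ℕ) :
    ∃ φ : (Finset.range k → Fin n) → ℝ, ∀ j : ℕ → Fin n,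
      sgdCoeff s ξ η c r j k = φ fun l => j (l + 1) := by
  have hcongr : ∀ (k : ℕ) (j j' : ℕ → Fin n), (∀ l < k, j (l + 1) = j' (l + 1)) →
      sgdCoeff s ξ η c r j k = sgdCoeff s ξ η c r j' k := by
    intro k j j'
    induction k with
    | zero => exact fun _ => rfl
    | succ k ih =>
      intro h
      simp only [sgdCoeff, ih fun l hl => h l (hl.trans k.lt_succ_self), h k k.lt_succ_self]
  refine ⟨fun u => sgdCoeff s ξ η c r
    (fun l => if h : l - 1 ∈ Finset.range k then u ⟨l - 1, h⟩ else r) k, fun j => ?_⟩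
  refine hcongr k _ _ fun l hl => ?_
  simp [hl]

/-! ### Second moments of the coordinates -/

section Moments

variable {Ω : Type*} [MeasurableSpace Ω] {P : Measure Ω} {n : ℕ} {i : ℕ → Ω → Fin n}

lemma IsUniformSampling.measurable_draws (hi : IsUniformSampling P i) (k : ℕ) :
    Measurable fun ω (l : Finset.range k) => i (l + 1) ω :=
  measurable_pi_lambda _ fun l => hi.measurable _ (Nat.le_add_left 1 l)

variable [IsProbabilityMeasure P]

lemma IsUniformSampling.integrable_comp_draws (hi : IsUniformSampling P i) (k : ℕ)
    (g : (Finset.range k → Fin n) → ℝ) : Integrable (fun ω => g fun l => i (l + 1) ω) P :=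
  have : IsFiniteMeasure (P.map fun ω (l : Finset.range k) => i (l + 1) ω) := inferInstance
  (Integrable.of_finite (f := g)).comp_measurable (hi.measurable_draws k)

/-- The draw `k + 1` is independent of the first `k` draws and hits each row with probability
`n⁻¹`. -/
lemma IsUniformSampling.integral_ite (hi : IsUniformSampling P i) (r : Fin n) (k : ℕ)
    (g h : (Finset.range k → Fin n) → ℝ) :
    ∫ ω, (if i (k + 1) ω = r then g fun l => i (l + 1) ω else h fun l => i (l + 1) ω) ∂P
      = (n : ℝ)⁻¹ * ∫ ω, g (fun l => i (l + 1) ω) ∂P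
        + (1 - (n : ℝ)⁻¹) * ∫ ω, h (fun l => i (l + 1) ω) ∂P := by
  have hg := hi.integrable_comp_draws k g
  have hh := hi.integrable_comp_draws k h
  set D : Ω → Finset.range k → Fin n := fun ω l => i (l + 1) ω
  set X : Ω → ℝ := fun ω => ({r} : Set (Fin n)).indicator 1 (i (k + 1) ω) with hX
  have hXm : Measurable X :=
    (measurable_of_finite (({r} : Set (Fin n)).indicator (1 : Fin n → ℝ))).comp
      (hi.measurable (k + 1) (Nat.le_add_left 1 k))
  have hXint : ∫ ω, X ω ∂P = (n : ℝ)⁻¹ := by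
    have : X = (i (k + 1) ⁻¹' {r}).indicator 1 := rfl
    rw [this, integral_indicator_one
      (hi.measurable (k + 1) (Nat.le_add_left 1 k) (measurableSet_singleton r))]
    change (P {ω | i (k + 1) ω = r}).toReal = _
    rw [hi.uniform (k + 1) (Nat.le_add_left 1 k) r]
    simp
  have hind : IndepFun X (fun ω => g (D ω) - h (D ω)) P := by
    have h0 := hi.indep.indepFun_finset {k} (Finset.range k) (by simp)
      fun l => hi.measurable _ (Nat.le_add_left 1 l)
    exact h0.comp
      (φ := fun u => ({r} : Set (Fin n)).indicator (1 : Fin n → ℝ) (u ⟨k, by simp⟩))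
      (ψ := fun u => g u - h u) (measurable_of_finite _) (measurable_of_finite _)
  have hmul := hind.integral_fun_mul_eq_mul_integral hXm.aestronglyMeasurable
    (hg.sub hh).aestronglyMeasurable
  have hXgh : Integrable (fun ω => X ω * (g (D ω) - h (D ω))) P :=
    hind.integrable_mul (by
      have : X = (i (k + 1) ⁻¹' {r}).indicator 1 := rfl
      rw [this]
      exact (integrable_const (1 : ℝ)).indicator
        (hi.measurable (k + 1) (Nat.le_add_left 1 k) (measurableSet_singleton r))) (hg.sub hh)
  have heq : (fun ω => if i (k + 1) ω = r then g (D ω) else h (D ω))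
      = fun ω => h (D ω) + X ω * (g (D ω) - h (D ω)) := by
    funext ω
    by_cases hω : i (k + 1) ω = r <;> simp [hX, hω]
  rw [heq, integral_add hh hXgh, hmul, hXint, integral_sub hg hh]
  ring

lemma IsUniformSampling.integrable_sgdCoeff_sq (hi : IsUniformSampling P i) (s ξ : ℝ) (η : ℕ → ℝ)
    (c : ℝ) (r : Fin n) (k : ℕ) :
    Integrable (fun ω => sgdCoeff s ξ η c r (fun j => i j ω) k ^ 2) P := by
  obtain ⟨φ, hφ⟩ := exists_sgdCoeff_eq s ξ η c r k
  simp only [hφ]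
  exact hi.integrable_comp_draws k fun u => φ u ^ 2

/-- One step of the second moment. If the row is drawn, the coordinate becomes a convex combination
of itself and of `ξ / s`, with weights `1 - η s` and `η s`. -/
lemma IsUniformSampling.integral_sgdCoeff_sq_succ_le (hi : IsUniformSampling P i) {s : ℝ}
    (ξ : ℝ) {η : ℕ → ℝ} (hη : ∀ j, 0 ≤ η j) (hηs : ∀ j, η (j + 1) * s ≤ 1) (c : ℝ) (r : Fin n)
    (k : ℕ) :
    s * ∫ ω, sgdCoeff s ξ η c r (fun j => i j ω) (k + 1) ^ 2 ∂P
      ≤ (1 - η (k + 1) * (s / n)) * (s * ∫ ω, sgdCoeff s ξ η c r (fun j => i j ω) k ^ 2 ∂P)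
        + η (k + 1) * ξ ^ 2 / n := by
  obtain ⟨φ, hφ⟩ := exists_sgdCoeff_eq s ξ η c r k
  set t := η (k + 1)
  have hsplit := hi.integral_ite r k (fun u => (φ u - t * (s * φ u - ξ)) ^ 2) (fun u => φ u ^ 2)
  have hstep : (fun ω => sgdCoeff s ξ η c r (fun j => i j ω) (k + 1) ^ 2) = fun ω =>
      if i (k + 1) ω = r then
        (φ (fun l => i (l + 1) ω) - t * (s * φ (fun l => i (l + 1) ω) - ξ)) ^ 2
      else φ (fun l => i (l + 1) ω) ^ 2 := by
    funext ω
    simp only [sgdCoeff, hφ, t]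
    split_ifs <;> rfl
  have hconv : s * ∫ ω, (φ (fun l => i (l + 1) ω) - t * (s * φ (fun l => i (l + 1) ω) - ξ)) ^ 2 ∂P
      ≤ (1 - t * s) * (s * ∫ ω, φ (fun l => i (l + 1) ω) ^ 2 ∂P) + t * ξ ^ 2 := by
    have hint := hi.integrable_comp_draws k fun u => φ u ^ 2
    rw [← mul_assoc, ← integral_const_mul, ← integral_const_mul]
    calc _ ≤ ∫ ω, ((1 - t * s) * s * φ (fun l => i (l + 1) ω) ^ 2 + t * ξ ^ 2) ∂P := by
          refine integral_mono
            ((hi.integrable_comp_draws k fun u => (φ u - t * (s * φ u - ξ)) ^ 2).const_mul s)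
            ((hint.const_mul _).add (integrable_const _)) fun ω => ?_
          generalize φ (fun l => i (l + 1) ω) = x
          -- The difference of the two sides is `t (1 - t s) (s x - ξ)²`.
          have := mul_nonneg (mul_nonneg (hη (k + 1)) (sub_nonneg.2 (hηs k)))
            (sq_nonneg (s * x - ξ))
          simp only
          nlinarith
      _ = _ := by
          rw [integral_add (hint.const_mul _) (integrable_const _)]
          simp
  have hn : (0 : ℝ) ≤ (n : ℝ)⁻¹ := by positivity
  rw [hstep, hsplit]
  simp only [hφ]
  have := mul_le_mul_of_nonneg_left hconv hn
  rw [div_eq_mul_inv s, div_eq_mul_inv (t * ξ ^ 2)]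
  linarith

lemma IsUniformSampling.integral_sgdCoeff_sq_le (hi : IsUniformSampling P i) {s : ℝ}
    (hs : 0 ≤ s) (ξ : ℝ) {η : ℕ → ℝ} (hη : ∀ j, 0 ≤ η j) (hηs : ∀ j, η (j + 1) * s ≤ 1) (c : ℝ)
    (r : Fin n) (k : ℕ) :
    s * ∫ ω, sgdCoeff s ξ η c r (fun j => i j ω) k ^ 2 ∂P
      ≤ Real.exp (-(s / n * ∑ j ∈ Finset.range k, η (j + 1))) * (s * c ^ 2)
        + ξ ^ 2 / n * ∑ j ∈ Finset.range k, η (j + 1) := by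
  induction k with
  | zero => simp [sgdCoeff]
  | succ k ih =>
    refine (hi.integral_sgdCoeff_sq_succ_le ξ hη hηs c r k).trans ?_
    set t := η (k + 1) * (s / n) with ht
    have hn : (1 : ℝ) ≤ n := by exact_mod_cast r.pos
    have ht0 : 0 ≤ t := mul_nonneg (hη _) (by positivity)
    have ht1 : t ≤ 1 := by
      rw [ht, ← mul_div_assoc]
      exact div_le_one_of_le₀ ((hηs k).trans hn) (by positivity)
    set S := ∑ j ∈ Finset.range k, η (j + 1) with hS
    have hS0 : 0 ≤ S := Finset.sum_nonneg fun j _ => hη _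
    have hnoise : 0 ≤ ξ ^ 2 / n * S := by positivity
    have hdecay : (1 - t) * (Real.exp (-(s / n * S)) * (s * c ^ 2))
        ≤ Real.exp (-(s / n * (S + η (k + 1)))) * (s * c ^ 2) := by
      rw [← mul_assoc]
      refine mul_le_mul_of_nonneg_right ?_ (by positivity)
      rw [show -(s / n * (S + η (k + 1))) = -t + -(s / n * S) by rw [ht]; ring, Real.exp_add]
      exact mul_le_mul_of_nonneg_right (Real.one_sub_le_exp_neg t) (Real.exp_nonneg _)
    rw [Finset.sum_range_succ]
    calc _ ≤ (1 - t) * (Real.exp (-(s / n * S)) * (s * c ^ 2) + ξ ^ 2 / n * S)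
          + η (k + 1) * ξ ^ 2 / n := by
            gcongr
      _ ≤ _ := by
            have : (1 - t) * (ξ ^ 2 / n * S) ≤ ξ ^ 2 / n * S :=
              mul_le_of_le_one_left hnoise (by linarith)
            have e : ξ ^ 2 / n * (S + η (k + 1)) = ξ ^ 2 / n * S + η (k + 1) * ξ ^ 2 / n := by ring
            rw [mul_add, e]
            linarith

end Moments

/-! ### Polynomially decaying stepsizes -/

lemma sum_stepsize_le {c₀ α : ℝ} (hc : 0 ≤ c₀) (hα₀ : 0 ≤ α) (hα₁ : α < 1) (k : ℕ) :
    ∑ j ∈ Finset.range k, stepsize c₀ α (j + 1) ≤ c₀ / (1 - α) * (k : ℝ) ^ (1 - α) := by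
  have hα : 0 < 1 - α := by linarith
  induction k with
  | zero => simp [Real.zero_rpow hα.ne']
  | succ k ih =>
    rw [Finset.sum_range_succ]
    -- By Bernoulli's inequality, `k^(1-α) ≤ (k+1)^(1-α) - (1-α) (k+1)^(-α)`.
    have hk : (0 : ℝ) < (k : ℝ) + 1 := by positivity
    have hbern := rpow_one_add_le_one_add_mul_self (s := -((k : ℝ) + 1)⁻¹)
      (neg_le_neg (inv_le_one_of_one_le₀ (by simp))) hα.le (by linarith : 1 - α ≤ 1)
    have hbase : 1 + -((k : ℝ) + 1)⁻¹ = k / (k + 1) := by field_simp; ring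
    rw [hbase, Real.div_rpow (by positivity) hk.le, div_le_iff₀ (by positivity)] at hbern
    have hpow : ((k : ℝ) + 1) ^ (-α) = ((k : ℝ) + 1)⁻¹ * ((k : ℝ) + 1) ^ (1 - α) := by
      rw [← Real.rpow_neg_one, ← Real.rpow_add hk]
      ring_nf
    have hstep : stepsize c₀ α (k + 1)
        ≤ c₀ / (1 - α) * (((k : ℝ) + 1) ^ (1 - α) - (k : ℝ) ^ (1 - α)) := by
      rw [stepsize, div_mul_eq_mul_div, le_div_iff₀ hα, mul_assoc]
      refine mul_le_mul_of_nonneg_left ?_ hc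
      push_cast
      rw [hpow]
      linarith
    push_cast
    linarith

lemma le_sum_stepsize {c₀ α : ℝ} (hc : 0 ≤ c₀) (hα₀ : 0 ≤ α) (k : ℕ) :
    c₀ * ((k : ℝ) + 1) ^ (1 - α) ≤ ∑ j ∈ Finset.range (k + 1), stepsize c₀ α (j + 1) := by
  have hk : (0 : ℝ) < (k : ℝ) + 1 := by positivity
  calc c₀ * ((k : ℝ) + 1) ^ (1 - α)
      = ∑ _j ∈ Finset.range (k + 1), c₀ * ((k : ℝ) + 1) ^ (-α) := by
        rw [Finset.sum_const, Finset.card_range, nsmul_eq_mul, sub_eq_add_neg,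
          Real.rpow_add hk, Real.rpow_one]
        push_cast
        ring
    _ ≤ _ := by
        refine Finset.sum_le_sum fun j hj => ?_
        rw [stepsize]
        refine mul_le_mul_of_nonneg_left ?_ hc
        refine Real.rpow_le_rpow_of_nonpos (by positivity) ?_ (by linarith)
        have : (j : ℝ) ≤ k := by exact_mod_cast Nat.lt_succ_iff.1 (Finset.mem_range.1 hj)
        push_cast
        linarith

lemma rpow_mul_exp_neg_le {x p : ℝ} (hx : 0 ≤ x) (hp : 0 < p) :
    x ^ p * Real.exp (-x) ≤ p ^ p := by
  have h : x ≤ p * Real.exp (x / p) := by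
    have := Real.add_one_le_exp (x / p)
    rw [← div_le_iff₀' hp]
    linarith
  calc x ^ p * Real.exp (-x) ≤ (p * Real.exp (x / p)) ^ p * Real.exp (-x) := by gcongr
    _ = p ^ p := by
      rw [Real.mul_rpow hp.le (Real.exp_nonneg _), ← Real.exp_mul, div_mul_cancel₀ _ hp.ne',
        mul_assoc, ← Real.exp_add, add_neg_cancel, Real.exp_zero, mul_one]

/-- The contraction of a coordinate, weighted by the source condition, decays at a rate uniform in
the eigenvalue `μ`. -/
lemma rpow_mul_exp_neg_sum_stepsize_le {c₀ α μ p : ℝ} (hc : 0 < c₀) (hα₀ : 0 ≤ α) (hμ : 0 ≤ μ)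
    (hcμ : c₀ * μ ≤ 1) (hp : 0 < p) (k : ℕ) :
    μ ^ p * Real.exp (-(μ * ∑ j ∈ Finset.range k, stepsize c₀ α (j + 1)))
      ≤ Real.exp 1 * (p / c₀) ^ p * ((k : ℝ) + 1) ^ (-(p * (1 - α))) := by
  have hk : (0 : ℝ) < (k : ℝ) + 1 := by positivity
  set T := ((k : ℝ) + 1) ^ (1 - α) with hT
  have hT0 : 0 < T := by positivity
  -- One more step costs at most a factor `e`, as `μ η_{k+1} ≤ 1`; this also covers `k = 0`.
  have hlast : μ * stepsize c₀ α (k + 1) ≤ 1 := by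
    have h1 : ((k : ℝ) + 1) ^ (-α) ≤ 1 :=
      Real.rpow_le_one_of_one_le_of_nonpos (by simp) (by linarith)
    calc μ * stepsize c₀ α (k + 1) = c₀ * μ * ((k : ℝ) + 1) ^ (-α) := by
          rw [stepsize]; push_cast; ring
      _ ≤ c₀ * μ * 1 := by gcongr
      _ ≤ 1 := by linarith
  have hsum := mul_le_mul_of_nonneg_left (le_sum_stepsize hc.le hα₀ k) hμ
  rw [Finset.sum_range_succ, mul_add] at hsum
  have hexp : Real.exp (-(μ * ∑ j ∈ Finset.range k, stepsize c₀ α (j + 1)))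
      ≤ Real.exp 1 * Real.exp (-(μ * (c₀ * T))) := by
    rw [← Real.exp_add]
    exact Real.exp_le_exp.2 (by linarith)
  have hscale : μ ^ p = (μ * (c₀ * T)) ^ p * (c₀ ^ p * T ^ p)⁻¹ := by
    rw [Real.mul_rpow hμ (by positivity), Real.mul_rpow hc.le hT0.le,
      mul_inv_cancel_right₀ (by positivity)]
  have hTp : ((k : ℝ) + 1) ^ (-(p * (1 - α))) = (T ^ p)⁻¹ := by
    rw [Real.rpow_neg hk.le, mul_comm, Real.rpow_mul hk.le]
  calc _ ≤ μ ^ p * (Real.exp 1 * Real.exp (-(μ * (c₀ * T)))) := by gcongr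
    _ = Real.exp 1 * (c₀ ^ p * T ^ p)⁻¹
        * ((μ * (c₀ * T)) ^ p * Real.exp (-(μ * (c₀ * T)))) := by
          rw [hscale]; ring
    _ ≤ Real.exp 1 * (c₀ ^ p * T ^ p)⁻¹ * p ^ p := by
          gcongr
          exact rpow_mul_exp_neg_le (by positivity) hp
    _ = _ := by
          rw [hTp, Real.div_rpow hp.le hc.le, mul_inv]
          ring

/-! ### The error bound and the a priori stopping rule -/

section Error

variable {n m : ℕ} {A : Matrix (Fin n) (Fin m) ℝ} {c₀ ν α : ℝ}
  {x₁ xdag w : EuclideanSpace ℝ (Fin m)} {ydag : EuclideanSpace ℝ (Fin n)}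

/-- The initial coordinate of the error along `a_r`, according to the source condition. -/
noncomputable def initialCoeff (A : Matrix (Fin n) (Fin m) ℝ) (ν : ℝ)
    (w : EuclideanSpace ℝ (Fin m)) (r : Fin n) : ℝ :=
  -((‖rowVec A r‖ ^ 2 / n) ^ ν * (inner ℝ (rowVec A r) w / ‖rowVec A r‖ ^ 2))

lemma norm_sq_mul_initialCoeff_sq (A : Matrix (Fin n) (Fin m) ℝ) (ν : ℝ)
    (w : EuclideanSpace ℝ (Fin m)) (r : Fin n) :
    ‖rowVec A r‖ ^ 2 * initialCoeff A ν w r ^ 2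
      = (‖rowVec A r‖ ^ 2 / n) ^ (2 * ν) * (inner ℝ (rowVec A r) w ^ 2 / ‖rowVec A r‖ ^ 2) := by
  have hpow : (‖rowVec A r‖ ^ 2 / n) ^ (2 * ν) = ((‖rowVec A r‖ ^ 2 / n) ^ ν) ^ 2 := by
    rw [mul_comm, Real.rpow_mul (by positivity)]
    norm_cast
  rw [hpow, initialCoeff]
  by_cases h : rowVec A r = 0
  · simp [h]
  · have : ‖rowVec A r‖ ≠ 0 := by simpa using h
    field_simp

lemma sqError_succ_eq_sum (hx : Matrix.toEuclideanLin A xdag = ydag)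
    (hA : StandingAssumption A c₀ ν x₁ xdag w) (hν : ν ≠ 0) (ξ : EuclideanSpace ℝ (Fin n))
    (η : ℕ → ℝ) {Ω : Type*} (i : ℕ → Ω → Fin n) (k : ℕ) (ω : Ω) :
    sqError A (ydag + ξ) η x₁ xdag i (k + 1) ω
      = ∑ r, sgdCoeff (‖rowVec A r‖ ^ 2) (ξ r) η (initialCoeff A ν w r) r
          (fun j => i j ω) k ^ 2 * ‖rowVec A r‖ ^ 2 := by
  have ha := hA.diagonal.pairwise_inner_rowVec
  have hc : x₁ - xdag = ∑ r, initialCoeff A ν w r • rowVec A r := by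
    rw [← neg_sub, hA.source, fracPow_normalMatrix_apply ha hν, ← Finset.sum_neg_distrib]
    exact Finset.sum_congr rfl fun r _ => (neg_smul _ _).symm
  rw [sqError, sgd_sub_eq_sum ha hx ξ η hc, norm_sum_smul_sq_of_orthogonal ha]

variable {Ω : Type*} [MeasurableSpace Ω] {P : Measure Ω} [IsProbabilityMeasure P] {i : ℕ → Ω → Fin n}

lemma integrable_sqError_succ (hx : Matrix.toEuclideanLin A xdag = ydag)
    (hA : StandingAssumption A c₀ ν x₁ xdag w) (hν : ν ≠ 0) (hi : IsUniformSampling P i)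
    (ξ : EuclideanSpace ℝ (Fin n)) (η : ℕ → ℝ) (k : ℕ) :
    Integrable (sqError A (ydag + ξ) η x₁ xdag i (k + 1)) P := by
  rw [show sqError A (ydag + ξ) η x₁ xdag i (k + 1) = _ from
    funext fun ω => sqError_succ_eq_sum hx hA hν ξ η i k ω]
  exact integrable_finsetSum _ fun r _ => (hi.integrable_sgdCoeff_sq _ _ _ _ r k).mul_const _

/-- The decay factor of each coordinate is bounded uniformly, and the coordinates of `w` are summed
by Bessel's inequality. -/
lemma integral_sqError_succ_le (hx : Matrix.toEuclideanLin A xdag = ydag)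
    (hA : StandingAssumption A c₀ ν x₁ xdag w) (hν : 0 < ν) (hα₀ : 0 ≤ α) (hα₁ : α < 1)
    (hc : 0 < c₀) (hi : IsUniformSampling P i) (ξ : EuclideanSpace ℝ (Fin n)) (k : ℕ) :
    ∫ ω, sqError A (ydag + ξ) (stepsize c₀ α) x₁ xdag i (k + 1) ω ∂P
      ≤ Real.exp 1 * (2 * ν / c₀) ^ (2 * ν) * ((k : ℝ) + 1) ^ (-(2 * ν * (1 - α))) * ‖w‖ ^ 2
        + c₀ / (1 - α) * ‖ξ‖ ^ 2 * ((k : ℝ) + 1) ^ (1 - α) := by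
  have ha := hA.diagonal.pairwise_inner_rowVec
  have hα : 0 < 1 - α := by linarith
  set K := Real.exp 1 * (2 * ν / c₀) ^ (2 * ν) * ((k : ℝ) + 1) ^ (-(2 * ν * (1 - α))) with hK
  set N := c₀ / (1 - α) * ((k : ℝ) + 1) ^ (1 - α) with hN
  have hK0 : 0 ≤ K := by positivity
  have hη : ∀ j, 0 ≤ stepsize c₀ α j := fun j => by rw [stepsize]; positivity
  have hηs : ∀ r j, stepsize c₀ α (j + 1) * ‖rowVec A r‖ ^ 2 ≤ 1 := by
    intro r j
    have h1 : (((j + 1 : ℕ) : ℝ)) ^ (-α) ≤ 1 :=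
      Real.rpow_le_one_of_one_le_of_nonpos (by simp) (by linarith)
    calc stepsize c₀ α (j + 1) * ‖rowVec A r‖ ^ 2
        = c₀ * ‖rowVec A r‖ ^ 2 * ((j + 1 : ℕ) : ℝ) ^ (-α) := by rw [stepsize]; ring
      _ ≤ c₀ * ‖rowVec A r‖ ^ 2 * 1 := by gcongr
      _ ≤ 1 := by linarith [hA.step_row r]
  have hcoord : ∀ r, ‖rowVec A r‖ ^ 2 * ∫ ω, sgdCoeff (‖rowVec A r‖ ^ 2) (ξ r) (stepsize c₀ α)
      (initialCoeff A ν w r) r (fun j => i j ω) k ^ 2 ∂P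
      ≤ K * (inner ℝ (rowVec A r) w ^ 2 / ‖rowVec A r‖ ^ 2) + N * ξ r ^ 2 := by
    intro r
    have hn : (1 : ℝ) ≤ n := by exact_mod_cast r.pos
    refine (hi.integral_sgdCoeff_sq_le (sq_nonneg _) (ξ r) hη (hηs r) _ r k).trans ?_
    refine add_le_add ?_ ?_
    · rw [norm_sq_mul_initialCoeff_sq, ← mul_assoc, mul_comm (Real.exp _)]
      refine mul_le_mul_of_nonneg_right ?_ (by positivity)
      refine rpow_mul_exp_neg_sum_stepsize_le hc hα₀ (by positivity) ?_ (by positivity) k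
      rw [← mul_div_assoc]
      exact div_le_one_of_le₀ ((hA.step_row r).trans hn) (by positivity)
    · rw [mul_comm]
      refine mul_le_mul ?_ (div_le_self (sq_nonneg _) hn) (by positivity) (by positivity)
      refine (sum_stepsize_le hc.le hα₀ hα₁ k).trans ?_
      have : (k : ℝ) ^ (1 - α) ≤ ((k : ℝ) + 1) ^ (1 - α) :=
        Real.rpow_le_rpow (by positivity) (by linarith) hα.le
      exact mul_le_mul_of_nonneg_left this (by positivity)
  rw [funext fun ω => sqError_succ_eq_sum hx hA hν.ne' ξ (stepsize c₀ α) i k ω,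
    integral_finsetSum _ fun r _ => (hi.integrable_sgdCoeff_sq _ _ _ _ r k).mul_const _]
  calc _ ≤ ∑ r, (K * (inner ℝ (rowVec A r) w ^ 2 / ‖rowVec A r‖ ^ 2) + N * ξ r ^ 2) := by
        refine Finset.sum_le_sum fun r _ => ?_
        rw [integral_mul_const, mul_comm]
        exact hcoord r
    _ = K * ∑ r, inner ℝ (rowVec A r) w ^ 2 / ‖rowVec A r‖ ^ 2 + N * ‖ξ‖ ^ 2 := by
        rw [Finset.sum_add_distrib, ← Finset.mul_sum, ← Finset.mul_sum,
          EuclideanSpace.real_norm_sq_eq]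
    _ ≤ K * ‖w‖ ^ 2 + N * ‖ξ‖ ^ 2 := by
        gcongr
        exact sum_inner_sq_div_norm_sq_le ha w
    _ = _ := by rw [hN]; ring

end Error

/-- At a stopping index `k` comparable to `(ρ / δ) ^ (2 / ((1 + 2ν)(1 - α)))` both terms of the
error bound are of the order `ρ ^ (2 / (1 + 2ν)) δ ^ (4ν / (1 + 2ν))`. -/
lemma sqrt_le_of_stopping_index {ν α cs css a b ρ δ k E : ℝ} (hν : 0 < ν) (hα₁ : α < 1)
    (hcs : 0 ≤ cs) (hcss : 0 ≤ css) (ha : 0 < a) (hb : 0 < b) (hρ : 0 ≤ ρ) (hδ : 0 < δ)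
    (hk : 0 < k) (hE : E ≤ cs * k ^ (-(2 * ν * (1 - α))) * ρ ^ 2 + css * δ ^ 2 * k ^ (1 - α))
    (hak : a * (ρ / δ) ^ (2 / ((1 + 2 * ν) * (1 - α))) ≤ k)
    (hkb : k ≤ b * (ρ / δ) ^ (2 / ((1 + 2 * ν) * (1 - α)))) :
    √E ≤ √(cs * a ^ (-(2 * ν * (1 - α))) + css * b ^ (1 - α))
      * ρ ^ (1 / (1 + 2 * ν)) * δ ^ (2 * ν / (1 + 2 * ν)) := by
  have hα : 0 < 1 - α := by linarith
  have hν' : 0 < 1 + 2 * ν := by linarith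
  -- For `ρ = 0` the upper bound on `k` contradicts `0 < k`.
  have hρ0 : 0 < ρ := by
    refine hρ.lt_of_ne fun h => ?_
    rw [← h, zero_div, Real.zero_rpow (by positivity), mul_zero] at hkb
    linarith
  set R := (ρ / δ) ^ (2 / ((1 + 2 * ν) * (1 - α))) with hR
  have hR0 : 0 < R := by positivity
  set G := ρ ^ (1 / (1 + 2 * ν)) * δ ^ (2 * ν / (1 + 2 * ν)) with hG
  have hG0 : 0 ≤ G := by positivity
  have hG2 : G ^ 2 = ρ ^ (2 / (1 + 2 * ν)) * δ ^ (4 * ν / (1 + 2 * ν)) := by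
    rw [hG, mul_pow, ← Real.rpow_natCast, ← Real.rpow_natCast (δ ^ _), ← Real.rpow_mul hρ,
      ← Real.rpow_mul hδ.le]
    congr 2 <;> push_cast <;> ring
  have hnoise : δ ^ 2 * R ^ (1 - α) = G ^ 2 := by
    have e1 : 2 / ((1 + 2 * ν) * (1 - α)) * (1 - α) = 2 / (1 + 2 * ν) := by field_simp
    have e2 : (2 : ℝ) = 2 / (1 + 2 * ν) + 4 * ν / (1 + 2 * ν) := by field_simp; ring
    have hδ2 : δ ^ 2 = δ ^ (2 / (1 + 2 * ν)) * δ ^ (4 * ν / (1 + 2 * ν)) := by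
      rw [← Real.rpow_add hδ, ← e2]; norm_cast
    rw [hG2, hR, ← Real.rpow_mul (by positivity), e1, Real.div_rpow hρ hδ.le, hδ2]
    field_simp
  have hbias : R ^ (-(2 * ν * (1 - α))) * ρ ^ 2 = G ^ 2 := by
    have e1 : 2 / ((1 + 2 * ν) * (1 - α)) * (-(2 * ν * (1 - α))) = -(4 * ν / (1 + 2 * ν)) := by
      field_simp; ring
    have e2 : (2 : ℝ) = 2 / (1 + 2 * ν) + 4 * ν / (1 + 2 * ν) := by field_simp; ring
    have hρ2 : ρ ^ 2 = ρ ^ (2 / (1 + 2 * ν)) * ρ ^ (4 * ν / (1 + 2 * ν)) := by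
      rw [← Real.rpow_add hρ0, ← e2]; norm_cast
    rw [hG2, hR, ← Real.rpow_mul (by positivity), e1, Real.rpow_neg (by positivity),
      Real.div_rpow hρ hδ.le, hρ2]
    field_simp
  have hlow : k ^ (-(2 * ν * (1 - α)))
      ≤ a ^ (-(2 * ν * (1 - α))) * R ^ (-(2 * ν * (1 - α))) := by
    rw [← Real.mul_rpow ha.le hR0.le]
    exact Real.rpow_le_rpow_of_nonpos (by positivity) hak
      (neg_nonpos.2 (by positivity))
  have hupp : k ^ (1 - α) ≤ b ^ (1 - α) * R ^ (1 - α) := by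
    rw [← Real.mul_rpow hb.le hR0.le]
    exact Real.rpow_le_rpow hk.le hkb hα.le
  have hle : E ≤ (cs * a ^ (-(2 * ν * (1 - α))) + css * b ^ (1 - α)) * G ^ 2 := by
    calc E ≤ cs * (a ^ (-(2 * ν * (1 - α))) * R ^ (-(2 * ν * (1 - α)))) * ρ ^ 2
          + css * δ ^ 2 * (b ^ (1 - α) * R ^ (1 - α)) := hE.trans (by gcongr)
      _ = cs * a ^ (-(2 * ν * (1 - α))) * (R ^ (-(2 * ν * (1 - α))) * ρ ^ 2)
          + css * b ^ (1 - α) * (δ ^ 2 * R ^ (1 - α)) := by ring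
      _ = _ := by rw [hbias, hnoise]; ring
  calc √E ≤ √((cs * a ^ (-(2 * ν * (1 - α))) + css * b ^ (1 - α)) * G ^ 2) := Real.sqrt_le_sqrt hle
    _ = _ := by rw [Real.sqrt_mul (by positivity), Real.sqrt_sq hG0, hG,
          mul_assoc _ (ρ ^ _)]

theorem theorem1p1 (ν α : ℝ) (hν : 1 / 2 < ν) (hα₀ : 0 ≤ α) (hα₁ : α < 1) :
    ∃ κ : ℝ, 0 < κ ∧ ∀ (n : ℕ), 1 ≤ n → ∀ c₀ : ℝ, 0 < c₀ → c₀ ≤ κ / n →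
      ∃ (cs css : ℝ) (C : ℝ → ℝ → ℝ),
        ∀ (m : ℕ) (A : Matrix (Fin n) (Fin m) ℝ) (x₁ xdag w : EuclideanSpace ℝ (Fin m))
          (ydag ξ : EuclideanSpace ℝ (Fin n))
          (Ω : Type*) [MeasurableSpace Ω] (P : Measure Ω) [IsProbabilityMeasure P]
          (i : ℕ → Ω → Fin n),
          IsMinNormSolution A ydag x₁ xdag →
          StandingAssumption A c₀ ν x₁ xdag w →
          IsUniformSampling P i →
          ∀ k : ℕ, 1 ≤ k →
            Integrable (sqError A (ydag + ξ) (stepsize c₀ α) x₁ xdag i k) P ∧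
            (∫ ω, sqError A (ydag + ξ) (stepsize c₀ α) x₁ xdag i k ω ∂P ≤
              cs * (k : ℝ) ^ (-(2 * ν * (1 - α))) * ‖w‖ ^ 2
                + css * ‖ξ‖ ^ 2 * (k : ℝ) ^ (1 - α)) ∧
            (∀ a b : ℝ, 0 < a → 0 < b → 0 < ‖ξ‖ →
              a * (‖w‖ / ‖ξ‖) ^ (2 / ((1 + 2 * ν) * (1 - α))) ≤ k →
              k ≤ b * (‖w‖ / ‖ξ‖) ^ (2 / ((1 + 2 * ν) * (1 - α))) →
              Real.sqrt (∫ ω, sqError A (ydag + ξ) (stepsize c₀ α) x₁ xdag i k ω ∂P) ≤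
                C a b * ‖w‖ ^ (1 / (1 + 2 * ν)) * ‖ξ‖ ^ (2 * ν / (1 + 2 * ν))) := by
  have hν₀ : 0 < ν := by linarith
  have hα : 0 < 1 - α := by linarith
  -- The coordinates decouple, so that the bounds on `c₀` in the standing assumptions suffice and
  -- any `κ > 0` will do.
  refine ⟨1, one_pos, fun n _ c₀ hc _ => ⟨Real.exp 1 * (2 * ν / c₀) ^ (2 * ν), c₀ / (1 - α),
    fun a b => √(Real.exp 1 * (2 * ν / c₀) ^ (2 * ν) * a ^ (-(2 * ν * (1 - α)))
      + c₀ / (1 - α) * b ^ (1 - α)), ?_⟩⟩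
  intro m A x₁ xdag w ydag ξ Ω _ P _ i hx hA hi k hk
  obtain ⟨k, rfl⟩ := Nat.exists_eq_add_of_le' hk
  have hbound := integral_sqError_succ_le hx.1 hA hν₀ hα₀ hα₁ hc hi ξ k
  refine ⟨integrable_sqError_succ hx.1 hA hν₀.ne' hi ξ _ k, by exact_mod_cast hbound, ?_⟩
  intro a b ha hb hξ hak hkb
  exact sqrt_le_of_stopping_index hν₀ hα₁ (by positivity) (by positivity) ha hb (norm_nonneg w) hξ
    (by positivity) (by exact_mod_cast hbound) hak hkb
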